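/- Let $L\ge 4$ be even and let $u,\tau\in\mathbb R$. On the periodic $L\times L$ square lattice with sites $i\in(\mathbb Z/L)^2$ and two fermionic modes $a_{i\uparrow},a_{i\downarrow}$ per site, acting on the Fock space of all $2L^2$ modes, consider the Hubbard Hamiltonian $H=H_I+H_h$ with $$H_I=u\sum_i\bigl(a_{i\uparrow}^\dagger a_{i\uparrow}-\tfrac12\bigr)\bigl(a_{i\downarrow}^\dagger a_{i\downarrow}-\tfrac12\bigr),\qquad H_h=\sum_{\sigma\in\{\uparrow,\downarrow\}}\sum_{i,j}R_{ij}\,a_{i\sigma}^\dagger a_{j\sigma},$$ where $R_{ij}=\tau$ if $i,j$ are nearest neighbours and $R_{ij}=0$ otherwise. Call the unit square (plaquette) with corners $(x,y),(x+1,y),(x,y+1),(x+1,y+1)$ modulo $L$ pink if $x,y$ are both even and gold if $x,y$ are both odd. Let $R^p_{ij}=\tau$ (respectively $R^g_{ij}=\tau$) if $\{i,j\}$ is an edge of a pink (respectively gold) plaquette and $0$ otherwise, and let $H_h^p=\sum_\sigma\sum_{i,j}R^p_{ij}a_{i\sigma}^\dagger a_{j\sigma}$ and $H_h^g=\sum_\sigma\sum_{i,j}R^g_{ij}a_{i\sigma}^\dagger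 a_{j\sigma}$. Let $\|\cdot\|$ be the operator norm and $\|\cdot\|_1$ the trace norm. For an ordered decomposition into Hermitian operators $H_1,\dots,H_m$ define the second-order Trotter error constant $$W(H_1,\dots,H_m)=\frac1{12}\sum_{b}\Bigl\|\sum_{c>b,\,a>b}[[H_b,H_c],H_a]\Bigr\|+\frac1{24}\sum_b\Bigl\|\sum_{c>b}[[H_b,H_c],H_b]\Bigr\|,$$ and put $W_{SO2}=W(H_I,H_h)$ and $W_{PLAQ}=W(H_I,H_h^p,H_h^g)$. Then: 1. $H_h=H_h^p+H_h^g$, hence $H=H_I+H_h^p+H_h^g$, and for every $t\in\mathbb R$ $$\bigl\|e^{-itH}-e^{-iH_It/2}e^{-iH_h^pt/2}e^{-iH_h^gt}e^{-iH_h^pt/2}e^{-iH_It/2}\bigr\|\le W_{PLAQ}\,|t|^3 .$$ 2. $W_{SO2}=\frac1{12}\|[[H_I,H_h],H_h]\|+\frac1{24}\|[[H_I,H_h],H_I]\|$ and $$W_{PLAQ}=W_{SO2}+\frac1{12}\|[[H_h^p,H_h^g],H_h^g]\|+\frac1{24}\|[[H_h^p,H_h^g],H_h^p]\| .$$ 3.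 $\|[[H_h^p,H_h^g],H_h^g]\|=\|[[H_h^p,H_h^g],H_h^p]\|$, and therefore $W_{PLAQ}=W_{SO2}+\frac3{24}\|[[H_h^p,H_h^g],H_h^g]\|$. 4. $\|[[H_h^p,H_h^g],H_h^g]\|=\|[[R^p,R^g],R^g]\|_1$, and therefore $W_{PLAQ}=W_{SO2}+\frac3{24}\|[[R^p,R^g],R^g]\|_1$, an expression whose last term involves only $L^2\times L^2$ matrices. -/

import Mathlib

open scoped Matrix.Norms.L2Operator

noncomputable section

namespace PlaquetteTrotter

/-! ### Fermionic Fock space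

For a finite linearly ordered set `M` of fermionic modes, the Fock space has the orthonormal basis
of occupation-number states, indexed by the sets `S : Finset M` of filled modes. Operators on it are
the complex matrices indexed by `Finset M`, with the operator norm coming from the Euclidean norm. -/

section Fock

/-- The operators on the Fock space over the modes `M`. -/
abbrev FockOp (M : Type*) : Type _ := Matrix (Finset M) (Finset M) ℂ

/-- The annihilation operator `a_m` (Jordan-Wigner convention): it sends the basis state of `S` to
`(-1) ^ #{k ∈ S | k < m}` times the basis state of `S \ {m}` if `m ∈ S`, and to `0` otherwise. -/
def annihilation {M : Type*} [LinearOrder M] (m : M) : FockOp M :=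
  Matrix.of fun T S =>
    if m ∈ S ∧ T = S.erase m then (-1) ^ (S.filter fun k => k < m).card else 0

/-- The creation operator `a_m†`. -/
def creation {M : Type*} [LinearOrder M] (m : M) : FockOp M :=
  (annihilation m).conjTranspose

/-- The number operator `n_m = a_m† a_m`. -/
def number {M : Type*} [Fintype M] [LinearOrder M] (m : M) : FockOp M :=
  creation m * annihilation m

end Fock

/-! ### The Hubbard model on the periodic square lattice -/

/-- The sites of the `L × L` lattice. -/
abbrev Site (L : ℕ) : Type := Fin L × Fin L

/-- The two spin directions: `0` is up and `1` is down. -/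
abbrev Spin : Type := Fin 2

/-- The fermionic modes, one for each site and each spin direction, ordered lexicographically. -/
abbrev Mode (L : ℕ) : Type := Fin L ×ₗ Fin L ×ₗ Spin

/-- The mode at site `i` with spin `σ`. -/
def mode {L : ℕ} (i : Site L) (σ : Spin) : Mode L := toLex (i.1, toLex (i.2, σ))

/-- The free-fermionic hopping Hamiltonian with coefficient matrix `R`, the same one in both spin
sectors: `∑_σ ∑_{i,j} R_{ij} a†_{iσ} a_{jσ}`. -/
def hopping {L : ℕ} (R : Matrix (Site L) (Site L) ℂ) : FockOp (Mode L) :=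
  ∑ σ : Spin, ∑ i : Site L, ∑ j : Site L,
    R i j • (creation (mode i σ) * annihilation (mode j σ))

/-- The interaction Hamiltonian `H_I = u ∑_i (n_{i↑} - 1/2) (n_{i↓} - 1/2)`. -/
def interactionH (L : ℕ) (u : ℝ) : FockOp (Mode L) :=
  (u : ℂ) • ∑ i : Site L,
    (number (mode i 0) - (1 / 2 : ℂ) • 1) * (number (mode i 1) - (1 / 2 : ℂ) • 1)

/-- `x` and `y` are neighbours on the cycle of length `L`. -/
abbrev CycleAdj {L : ℕ} (x y : Fin L) : Prop :=
  (x.val + 1) % L = y.val ∨ (y.val + 1) % L = x.val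

/-- `i` and `j` are nearest neighbours on the `L × L` lattice with periodic boundary conditions. -/
abbrev LatticeAdj {L : ℕ} (i j : Site L) : Prop :=
  (i.1 = j.1 ∧ CycleAdj i.2 j.2) ∨ (i.2 = j.2 ∧ CycleAdj i.1 j.1)

/-- The site `i` is one of the four corners of the plaquette with lower left corner `c`, whose
corners are the sites `(c.1 + δ, c.2 + ε)` modulo `L`, with `δ, ε ∈ {0, 1}`. -/
abbrev InPlaquette {L : ℕ} (c i : Site L) : Prop :=
  (i.1 = c.1 ∨ i.1.val = (c.1.val + 1) % L) ∧ (i.2 = c.2 ∨ i.2.val = (c.2.val + 1) % L)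

/-- `{i, j}` is an edge of a pink plaquette: one whose lower left corner has both coordinates
even. -/
abbrev PinkEdge {L : ℕ} (i j : Site L) : Prop :=
  LatticeAdj i j ∧
    ∃ c : Site L, Even c.1.val ∧ Even c.2.val ∧ InPlaquette c i ∧ InPlaquette c j

/-- `{i, j}` is an edge of a gold plaquette: one whose lower left corner has both coordinates
odd. -/
abbrev GoldEdge {L : ℕ} (i j : Site L) : Prop :=
  LatticeAdj i j ∧
    ∃ c : Site L, Odd c.1.val ∧ Odd c.2.val ∧ InPlaquette c i ∧ InPlaquette c j

/-- The hopping coefficients `R`: `τ` between nearest neighbours and `0` otherwise. -/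
def hopR (L : ℕ) (τ : ℝ) : Matrix (Site L) (Site L) ℂ :=
  Matrix.of fun i j => if LatticeAdj i j then (τ : ℂ) else 0

/-- The hopping coefficients `R^p` of the pink edges. -/
def pinkR (L : ℕ) (τ : ℝ) : Matrix (Site L) (Site L) ℂ :=
  Matrix.of fun i j => if PinkEdge i j then (τ : ℂ) else 0

/-- The hopping coefficients `R^g` of the gold edges. -/
def goldR (L : ℕ) (τ : ℝ) : Matrix (Site L) (Site L) ℂ :=
  Matrix.of fun i j => if GoldEdge i j then (τ : ℂ) else 0

/-- The hopping Hamiltonian `H_h`. -/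
def hopH (L : ℕ) (τ : ℝ) : FockOp (Mode L) := hopping (hopR L τ)

/-- The pink part `H_h^p` of the hopping Hamiltonian. -/
def pinkH (L : ℕ) (τ : ℝ) : FockOp (Mode L) := hopping (pinkR L τ)

/-- The gold part `H_h^g` of the hopping Hamiltonian. -/
def goldH (L : ℕ) (τ : ℝ) : FockOp (Mode L) := hopping (goldR L τ)

/-- The Hubbard Hamiltonian `H = H_I + H_h`. -/
def hubbardH (L : ℕ) (u τ : ℝ) : FockOp (Mode L) := interactionH L u + hopH L τ

/-! ### Trotter steps and error constants -/

/-- The evolution operator `e^{-i t H}`. -/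
def evolution {n : Type*} [Fintype n] [DecidableEq n] (H : Matrix n n ℂ) (t : ℝ) : Matrix n n ℂ :=
  NormedSpace.exp ((-Complex.I * (t : ℂ)) • H)

/-- A second-order plaquette Trotter step
`e^{-i H_I t/2} e^{-i H_h^p t/2} e^{-i H_h^g t} e^{-i H_h^p t/2} e^{-i H_I t/2}`. -/
def plaquetteStep (L : ℕ) (u τ t : ℝ) : FockOp (Mode L) :=
  evolution (interactionH L u) (t / 2) * evolution (pinkH L τ) (t / 2) *
    evolution (goldH L τ) t *
      evolution (pinkH L τ) (t / 2) * evolution (interactionH L u) (t / 2)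

/-- The second-order Trotter error constant of an ordered decomposition `H_1, …, H_m`:
`(1/12) ∑_b ‖∑_{c>b, a>b} [[H_b, H_c], H_a]‖ + (1/24) ∑_b ‖∑_{c>b} [[H_b, H_c], H_b]‖`.
(The summands with `b = m` are zero.) -/
def trotterW {n : Type*} [Fintype n] [DecidableEq n] {m : ℕ} (H : Fin m → Matrix n n ℂ) : ℝ :=
  (1 / 12) * ∑ b : Fin m, ‖∑ c ∈ Finset.Ioi b, ∑ a ∈ Finset.Ioi b, ⁅⁅H b, H c⁆, H a⁆‖ +
    (1 / 24) * ∑ b : Fin m, ‖∑ c ∈ Finset.Ioi b, ⁅⁅H b, H c⁆, H b⁆‖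

/-- The error constant of the split-operator decomposition `H_1 = H_I`, `H_2 = H_h`. -/
def wSO2 (L : ℕ) (u τ : ℝ) : ℝ := trotterW ![interactionH L u, hopH L τ]

/-- The error constant of the plaquette decomposition `H_1 = H_I`, `H_2 = H_h^p`,
`H_3 = H_h^g`. -/
def wPLAQ (L : ℕ) (u τ : ℝ) : ℝ := trotterW ![interactionH L u, pinkH L τ, goldH L τ]

/-- The trace norm (Schatten 1-norm) `‖A‖₁ = tr √(A† A)`: the sum of the singular values. -/
def traceNorm {n : Type*} [Fintype n] [DecidableEq n] (A : Matrix n n ℂ) : ℝ :=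
  ∑ k : n, Real.sqrt ((Matrix.isHermitian_conjTranspose_mul_self A).eigenvalues k)

end PlaquetteTrotter

end

/-! Error bound. For skew-adjoint `a`, `b` the defect of `exp (t • a) * exp (t • b) * exp (t • a)`
against `exp (t • (a + b + a))` has, up to unitary factors, a derivative that is a difference of two
Taylor remainders of conjugations; the first-order terms cancel, and integrating an `s ^ 2` bound
gives the cubic bound `norm_symmetric_step_sub_exp_le`. The plaquette step nests two such steps:
`H_I` against `H_h`, then `H_h^p` against `H_h^g`. Unitary factors preserve the norm, so the two
errors add, which is also how `W_PLAQ` splits.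

Free-fermion evaluation. Second quantization is a Lie homomorphism (`lie_secondQuant`), so the
nested commutators of hopping terms are hopping operators of nested commutators of `R^p`, `R^g`.
These are Hermitian and traceless. Diagonalizing such a `K` and rotating the modes turns the
operator into a combination of number operators, whose largest eigenvalue fills the positive levels.
Tracelessness makes this half the sum of the absolute values, and the two spins double it to the
trace norm (`norm_hopping`).

Geometry. On an even cycle with `L ≥ 4` each edge lies in exactly one of the pairings even-odd and
odd-even, so `R = R^p + R^g`. The diagonal translation exchanges pink and gold. The symmetry is used
only for one-particle matrices; the trace norm carries it to Fock space. -/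

namespace PlaquetteTrotter

/-! ### Mean value estimates -/

section MeanValue

variable {E : Type*} [NormedAddCommGroup E] [NormedSpace ℝ E]

/-- A curve that starts at `0` and whose speed at time `s` is at most `c * s ^ n` is at distance at
most `c * t ^ (n + 1) / (n + 1)` from `0` at time `t`. -/
theorem norm_le_of_norm_deriv_le_pow {f f' : ℝ → E} (hf : ∀ s, HasDerivAt f (f' s) s)
    (h0 : f 0 = 0) {c : ℝ} {n : ℕ} (hc : ∀ s, 0 ≤ s → ‖f' s‖ ≤ c * s ^ n) {t : ℝ} (ht : 0 ≤ t) :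
    ‖f t‖ ≤ c * t ^ (n + 1) / (n + 1) := by
  refine image_norm_le_of_norm_deriv_right_le_deriv_boundary (f := f) (f' := f') (a := 0) (b := t)
    (B := fun s => c * s ^ (n + 1) / (n + 1)) (B' := fun s => c * s ^ n)
    (fun s _ => (hf s).continuousAt.continuousWithinAt) (fun s _ => (hf s).hasDerivWithinAt)
    (by simp [h0]) (fun s => ?_) (fun s hs => hc s hs.1) (Set.right_mem_Icc.2 ht)
  have h := (((hasDerivAt_id s).pow (n + 1)).const_mul c).div_const ((n : ℝ) + 1)
  have hn : (n : ℝ) + 1 ≠ 0 := by positivity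
  refine h.congr_deriv ?_
  simp
  field_simp

end MeanValue

/-! ### Conjugation by a one-parameter unitary group -/

section Conjugation

open NormedSpace

variable {A : Type*} [NormedRing A] [NormedAlgebra ℝ A] [CompleteSpace A]

theorem exp_smul_mul_exp_neg_smul (t : ℝ) (B : A) : exp (t • B) * exp (-t • B) = 1 := by
  let +nondep : NormedAlgebra ℚ A := .restrictScalars ℚ ℝ A
  rw [← exp_add_of_commute (((Commute.refl B).smul_left t).smul_right (-t)), ← add_smul]
  simp

theorem exp_neg_smul_mul_exp_smul (t : ℝ) (B : A) : exp (-t • B) * exp (t • B) = 1 := by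
  simpa using exp_smul_mul_exp_neg_smul (-t) B

theorem hasDerivAt_exp_neg_smul (B : A) (t : ℝ) :
    HasDerivAt (fun s : ℝ => exp (-s • B)) (-(B * exp (-t • B))) t := by
  have h := (hasDerivAt_exp_smul_const' B (-t)).scomp t (hasDerivAt_neg t)
  simpa [Function.comp_def] using h

theorem hasDerivAt_exp_conj (B X : A) (t : ℝ) :
    HasDerivAt (fun s : ℝ => exp (s • B) * X * exp (-s • B))
      (exp (t • B) * ⁅B, X⁆ * exp (-t • B)) t := by
  have h := ((hasDerivAt_exp_smul_const (𝕂 := ℝ) B t).mul_const X).mul (hasDerivAt_exp_neg_smul B t)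
  refine h.congr_deriv ?_
  rw [Ring.lie_def]
  noncomm_ring

variable [StarRing A] [CStarRing A] [StarModule ℝ A]

theorem exp_smul_mem_unitary {B : A} (hB : B ∈ skewAdjoint A) (t : ℝ) :
    exp (t • B) ∈ unitary A := by
  let +nondep : NormedAlgebra ℚ A := .restrictScalars ℚ ℝ A
  exact exp_mem_unitary_of_mem_skewAdjoint (skewAdjoint.smul_mem t hB)

theorem norm_exp_conj {B : A} (hB : B ∈ skewAdjoint A) (X : A) (t : ℝ) :
    ‖exp (t • B) * X * exp (-t • B)‖ = ‖X‖ := by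
  rw [CStarRing.norm_mul_mem_unitary _ (exp_smul_mem_unitary hB (-t)),
    CStarRing.norm_mem_unitary_mul _ (exp_smul_mem_unitary hB t)]

/-- The velocity of the conjugated curve is the conjugate of `⁅B, X⁆`, and conjugation by a unitary
is isometric, so the speed is constant. -/
theorem norm_exp_conj_sub_le {B : A} (hB : B ∈ skewAdjoint A) (X : A) {t : ℝ} (ht : 0 ≤ t) :
    ‖exp (t • B) * X * exp (-t • B) - X‖ ≤ ‖⁅B, X⁆‖ * t := by
  have h := norm_le_of_norm_deriv_le_pow (n := 0) (c := ‖⁅B, X⁆‖)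
    (fun s => (hasDerivAt_exp_conj B X s).sub_const X) (by simp)
    (fun s _ => by rw [norm_exp_conj hB]; simp) ht
  simpa using h

/-- The second-order Taylor estimate for the conjugation by a one-parameter unitary group. -/
theorem norm_exp_conj_sub_sub_le {B : A} (hB : B ∈ skewAdjoint A) (X : A) {t : ℝ} (ht : 0 ≤ t) :
    ‖exp (t • B) * X * exp (-t • B) - X - t • ⁅B, X⁆‖ ≤ ‖⁅B, ⁅B, X⁆⁆‖ * t ^ 2 / 2 := by
  have h := norm_le_of_norm_deriv_le_pow (n := 1) (c := ‖⁅B, ⁅B, X⁆⁆‖)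
    (fun s => ((hasDerivAt_exp_conj B X s).sub_const X).sub
      ((hasDerivAt_id s).smul_const ⁅B, X⁆)) (by simp)
    (fun s hs => ?_) ht
  · refine h.trans_eq ?_
    norm_num
  -- The derivative of the remainder is the first-order error for `⁅B, X⁆`.
  · simpa using norm_exp_conj_sub_le hB ⁅B, X⁆ hs

end Conjugation

/-! ### The error of second-order Trotter steps -/

section Trotter

open NormedSpace

variable {A : Type*} [NormedRing A] [NormedAlgebra ℝ A] [CompleteSpace A]

theorem hasDerivAt_exp_neg_smul' (B : A) (t : ℝ) :
    HasDerivAt (fun s : ℝ => exp (-s • B)) (-(exp (-t • B) * B)) t := by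
  have h := (hasDerivAt_exp_smul_const B (-t)).scomp t (hasDerivAt_neg t)
  simpa [Function.comp_def] using h

variable [StarRing A] [CStarRing A] [StarModule ℝ A]

/-- The curve `exp (-s • H) * S s - 1`, with `S` the symmetric product, has derivative `exp (-s • H)
* exp (s • a) * (r₂ - r₁) * exp (s • b) * exp (s • a)`, where `r₁`, `r₂` are second-order Taylor
remainders. The other factors are unitary. -/
theorem norm_symmetric_step_sub_exp_le_of_nonneg {a b : A} (ha : a ∈ skewAdjoint A)
    (hb : b ∈ skewAdjoint A) {t : ℝ} (ht : 0 ≤ t) :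
    ‖exp (t • a) * exp (t • b) * exp (t • a) - exp (t • (a + b + a))‖ ≤
      (‖⁅b, ⁅b, a⁆⁆‖ + ‖⁅a, ⁅a, b⁆⁆‖) * t ^ 3 / 6 := by
  set H := a + b + a with hH
  have hHs : H ∈ skewAdjoint A := add_mem (add_mem ha hb) ha
  set C := ‖⁅b, ⁅b, a⁆⁆‖ + ‖⁅a, ⁅a, b⁆⁆‖ with hC
  have hd (s : ℝ) := ((hasDerivAt_exp_neg_smul' H s).mul
    (((hasDerivAt_exp_smul_const' (𝕂 := ℝ) a s).mul (hasDerivAt_exp_smul_const (𝕂 := ℝ) b s)).mul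
      (hasDerivAt_exp_smul_const' (𝕂 := ℝ) a s))).sub_const 1
  have key := norm_le_of_norm_deriv_le_pow (n := 2) (c := C / 2) hd (by simp) (fun s hs => ?_) ht
  · have h1 : exp (t • a) * exp (t • b) * exp (t • a) - exp (t • H) =
        exp (t • H) * (exp (-t • H) * (exp (t • a) * exp (t • b) * exp (t • a)) - 1) := by
      rw [mul_sub, ← mul_assoc (exp (t • H)), exp_smul_mul_exp_neg_smul, one_mul, mul_one]
    rw [h1, CStarRing.norm_mem_unitary_mul _ (exp_smul_mem_unitary hHs t)]
    refine key.trans_eq ?_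
    norm_num
    ring
  · have e1 := exp_smul_mul_exp_neg_smul s a
    have e2 := exp_neg_smul_mul_exp_smul s b
    set r₁ := exp (s • -a) * b * exp (-s • -a) - b - s • ⁅-a, b⁆ with hr₁
    set r₂ := exp (s • b) * a * exp (-s • b) - a - s • ⁅b, a⁆ with hr₂
    have b1 : ‖r₁‖ ≤ ‖⁅a, ⁅a, b⁆⁆‖ * s ^ 2 / 2 := by
      have h := norm_exp_conj_sub_sub_le (neg_mem ha) b hs
      have h2 : ⁅-a, ⁅-a, b⁆⁆ = ⁅a, ⁅a, b⁆⁆ := by simp only [Ring.lie_def]; noncomm_ring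
      rwa [h2] at h
    have b2 : ‖r₂‖ ≤ ‖⁅b, ⁅b, a⁆⁆‖ * s ^ 2 / 2 := norm_exp_conj_sub_sub_le hb a hs
    have hr : r₂ - r₁ = b - exp (-s • a) * b * exp (s • a)
        + (exp (s • b) * a * exp (-s • b) - a) := by
      -- The symmetry of the step enters here: the two first-order terms coincide and drop out of
      -- `r₂ - r₁`.
      have h3 : s • ⁅-a, b⁆ = s • ⁅b, a⁆ := by
        congr 1; simp only [Ring.lie_def]; noncomm_ring
      rw [hr₁, hr₂, h3]
      simp only [smul_neg, neg_smul, neg_neg]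
      abel
    calc _ = ‖exp (-s • H) * (exp (s • a) * ((r₂ - r₁) * (exp (s • b) * exp (s • a))))‖ := by
          congr 1
          have h4 : exp (s • a) * ((r₂ - r₁) * (exp (s • b) * exp (s • a))) =
              exp (s • a) * b * exp (s • b) * exp (s • a)
              - (exp (s • a) * exp (-s • a)) * b * exp (s • a) * exp (s • b) * exp (s • a)
              + exp (s • a) * exp (s • b) * a * (exp (-s • b) * exp (s • b)) * exp (s • a)
              - exp (s • a) * a * exp (s • b) * exp (s • a) := by
            rw [hr]; noncomm_ring
          have h5 : exp (s • a) * a = a * exp (s • a) :=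
            (((Commute.refl a).smul_left s).exp_left).eq
          rw [h4, e1, e2, h5, hH]
          have h6 : b * exp (s • b) = exp (s • b) * b :=
            (((Commute.refl b).smul_left s).exp_left).eq.symm
          rw [mul_assoc (exp (s • a)) b, h6]
          simp only [Pi.mul_apply]
          noncomm_ring
      _ = ‖r₂ - r₁‖ := by
          rw [CStarRing.norm_mem_unitary_mul _ (exp_smul_mem_unitary hHs _),
            CStarRing.norm_mem_unitary_mul _ (exp_smul_mem_unitary ha _),
            CStarRing.norm_mul_mem_unitary _
              (mul_mem (exp_smul_mem_unitary hb _) (exp_smul_mem_unitary ha _))]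
      _ ≤ C / 2 * s ^ 2 := by
          refine (norm_sub_le _ _).trans ((add_le_add b2 b1).trans_eq ?_)
          rw [hC]; ring

theorem norm_symmetric_step_sub_exp_le {a b : A} (ha : a ∈ skewAdjoint A)
    (hb : b ∈ skewAdjoint A) (t : ℝ) :
    ‖exp (t • a) * exp (t • b) * exp (t • a) - exp (t • (a + b + a))‖ ≤
      (‖⁅b, ⁅b, a⁆⁆‖ + ‖⁅a, ⁅a, b⁆⁆‖) * |t| ^ 3 / 6 := by
  rcases le_total 0 t with ht | ht
  · rw [abs_of_nonneg ht]
    exact norm_symmetric_step_sub_exp_le_of_nonneg ha hb ht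
  -- Negative times reduce to `-a`, `-b` at time `-t`; a double commutator only changes sign.
  · have h := norm_symmetric_step_sub_exp_le_of_nonneg (neg_mem ha) (neg_mem hb)
      (neg_nonneg.2 ht)
    have h1 (x y : A) : ‖⁅-x, ⁅-x, -y⁆⁆‖ = ‖⁅x, ⁅x, y⁆⁆‖ := by
      rw [← norm_neg]; congr 1; simp only [Ring.lie_def]; noncomm_ring
    have h2 : -a + -b + -a = -(a + b + a) := by abel
    simpa only [h1, h2, neg_smul_neg, abs_of_nonpos ht] using h

end Trotter

section Evolution

variable {n : Type*} [Fintype n] [DecidableEq n]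

theorem evolution_eq_exp_smul (H : Matrix n n ℂ) (t : ℝ) :
    evolution H t = NormedSpace.exp (t • (-Complex.I • H)) := by
  rw [evolution, ← Complex.coe_smul, smul_smul, mul_comm]

theorem neg_I_smul_mem_skewAdjoint {H : Matrix n n ℂ} (hH : H.IsHermitian) :
    -Complex.I • H ∈ skewAdjoint (Matrix n n ℂ) := by
  rw [skewAdjoint.mem_iff, star_smul, Matrix.star_eq_conjTranspose, hH.eq]
  simp

theorem evolution_mem_unitary {H : Matrix n n ℂ} (hH : H.IsHermitian) (t : ℝ) :
    evolution H t ∈ unitary (Matrix n n ℂ) := by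
  rw [evolution_eq_exp_smul]
  exact exp_smul_mem_unitary (neg_I_smul_mem_skewAdjoint hH) t

theorem smul_lie_smul_lie_smul (c d : ℂ) (X Y : Matrix n n ℂ) :
    ⁅c • X, ⁅c • X, d • Y⁆⁆ = (c * c * d) • ⁅X, ⁅X, Y⁆⁆ := by
  have h1 (z w : ℂ) (U V : Matrix n n ℂ) : ⁅z • U, w • V⁆ = (z * w) • ⁅U, V⁆ := by
    rw [Ring.lie_def, Ring.lie_def, smul_mul_smul_comm, smul_mul_smul_comm, mul_comm w, smul_sub]
  rw [h1, h1, mul_assoc]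

/-- The error of a second-order Trotter step with two terms. -/
theorem norm_evolution_sub_two_term_step_le {A B : Matrix n n ℂ} (hA : A.IsHermitian)
    (hB : B.IsHermitian) (t : ℝ) :
    ‖evolution (A + B) t - evolution A (t / 2) * evolution B t * evolution A (t / 2)‖ ≤
      ((1 / 12) * ‖⁅⁅A, B⁆, B⁆‖ + (1 / 24) * ‖⁅⁅A, B⁆, A⁆‖) * |t| ^ 3 := by
  -- With `a = -iA/2` and `b = -iB` the double commutators acquire factors of modulus `1/2` and
  -- `1/4`; the common `1/6` turns these into `1/12` and `1/24`.
  have ha : (2⁻¹ : ℝ) • (-Complex.I • A) ∈ skewAdjoint (Matrix n n ℂ) :=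
    skewAdjoint.smul_mem _ (neg_I_smul_mem_skewAdjoint hA)
  have h := norm_symmetric_step_sub_exp_le ha (neg_I_smul_mem_skewAdjoint hB) t
  rw [norm_sub_rev]
  have e1 : evolution A (t / 2) = NormedSpace.exp (t • ((2⁻¹ : ℝ) • (-Complex.I • A))) := by
    rw [evolution_eq_exp_smul, smul_smul, div_eq_mul_inv]
  have e2 : (2⁻¹ : ℝ) • (-Complex.I • A) + -Complex.I • B + (2⁻¹ : ℝ) • (-Complex.I • A) =
      -Complex.I • (A + B) := by
    rw [add_right_comm, ← add_smul]
    norm_num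
  rw [e1, evolution_eq_exp_smul, evolution_eq_exp_smul, ← e2]
  refine h.trans_eq ?_
  have c1 : ⁅-Complex.I • B, ⁅-Complex.I • B, (2⁻¹ : ℝ) • (-Complex.I • A)⁆⁆ =
      (Complex.I / 2) • ⁅⁅A, B⁆, B⁆ := by
    have h1 : ⁅B, ⁅B, A⁆⁆ = ⁅⁅A, B⁆, B⁆ := by simp only [Ring.lie_def]; noncomm_ring
    rw [← Complex.coe_smul, smul_smul, smul_lie_smul_lie_smul, h1]
    congr 1
    push_cast
    linear_combination (-(Complex.I / 2)) * Complex.I_sq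
  have c2 : ⁅(2⁻¹ : ℝ) • (-Complex.I • A), ⁅(2⁻¹ : ℝ) • (-Complex.I • A), -Complex.I • B⁆⁆ =
      (-Complex.I / 4) • ⁅⁅A, B⁆, A⁆ := by
    have h1 : ⁅A, ⁅A, B⁆⁆ = -⁅⁅A, B⁆, A⁆ := by simp only [Ring.lie_def]; noncomm_ring
    rw [← Complex.coe_smul, smul_smul, smul_lie_smul_lie_smul, h1, smul_neg, ← neg_smul]
    congr 1
    push_cast
    linear_combination (Complex.I / 4) * Complex.I_sq
  rw [c1, c2, norm_smul, norm_smul]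
  simp
  ring

/-- The error of a second-order Trotter step with three terms. -/
theorem norm_evolution_sub_three_term_step_le {A B C : Matrix n n ℂ} (hA : A.IsHermitian)
    (hB : B.IsHermitian) (hC : C.IsHermitian) (t : ℝ) :
    ‖evolution (A + B + C) t - evolution A (t / 2) * evolution B (t / 2) * evolution C t *
        evolution B (t / 2) * evolution A (t / 2)‖ ≤
      ((1 / 12) * ‖⁅⁅A, B + C⁆, B + C⁆‖ + (1 / 24) * ‖⁅⁅A, B + C⁆, A⁆‖ +
        ((1 / 12) * ‖⁅⁅B, C⁆, C⁆‖ + (1 / 24) * ‖⁅⁅B, C⁆, B⁆‖)) * |t| ^ 3 := by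
  have h1 := norm_evolution_sub_two_term_step_le hA (hB.add hC) t
  have h2 := norm_evolution_sub_two_term_step_le hB hC t
  -- The inner error is flanked by the outer unitaries at no cost in norm; the triangle inequality
  -- then joins the two steps.
  rw [← CStarRing.norm_mem_unitary_mul _ (evolution_mem_unitary hA (t / 2)),
    ← CStarRing.norm_mul_mem_unitary _ (evolution_mem_unitary hA (t / 2))] at h2
  rw [add_mul]
  refine le_trans (le_trans (le_of_eq ?_) (norm_add_le _ _)) (add_le_add h1 h2)
  rw [← add_assoc]
  congr 1
  noncomm_ring

end Evolution

/-! ### Canonical anticommutation relations -/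

/-- The family `a` satisfies the canonical anticommutation relations. -/
structure IsCAR {ι A : Type*} [DecidableEq ι] [Ring A] [StarRing A] (a : ι → A) : Prop where
  anticomm : ∀ i j, a i * a j + a j * a i = 0
  anticomm_star : ∀ i j, a i * star (a j) + star (a j) * a i = if i = j then 1 else 0

/-- The second quantization `∑_{i,j} R_{ij} a_i† a_j` of a one-particle operator `R`. -/
def secondQuant {ι A : Type*} [Fintype ι] [Ring A] [StarRing A] [Algebra ℂ A] (a : ι → A)
    (R : Matrix ι ι ℂ) : A :=
  ∑ i, ∑ j, R i j • (star (a i) * a j)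

namespace IsCAR

section Algebraic

variable {ι A : Type*} [DecidableEq ι] [Ring A] [StarRing A] {a : ι → A}

theorem comp (h : IsCAR a) {κ : Type*} [DecidableEq κ] {f : κ → ι} (hf : Function.Injective f) :
    IsCAR (a ∘ f) where
  anticomm i j := h.anticomm (f i) (f j)
  anticomm_star i j := by simpa [hf.eq_iff] using h.anticomm_star (f i) (f j)

theorem mul_eq_neg (h : IsCAR a) (i j : ι) : a i * a j = -(a j * a i) :=
  eq_neg_of_add_eq_zero_left (h.anticomm i j)

theorem star_mul_star_eq_neg (h : IsCAR a) (i j : ι) :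
    star (a i) * star (a j) = -(star (a j) * star (a i)) := by
  rw [← star_mul, ← star_mul, h.mul_eq_neg, star_neg]

theorem mul_star_eq (h : IsCAR a) (i j : ι) :
    a i * star (a j) = (if i = j then 1 else 0) - star (a j) * a i :=
  eq_sub_of_add_eq (h.anticomm_star i j)

/-- Normal ordering leaves a quadratic contraction and a quartic term in each product. The quartic
terms agree after two sign changes and cancel. -/
theorem lie_star_mul (h : IsCAR a) (i j k l : ι) :
    ⁅star (a i) * a j, star (a k) * a l⁆ =
      (if j = k then star (a i) * a l else 0) - if i = l then star (a k) * a j else 0 := by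
  have e1 : star (a i) * a j * (star (a k) * a l) =
      (if j = k then star (a i) * a l else 0) - star (a i) * star (a k) * (a j * a l) := by
    rw [mul_assoc, ← mul_assoc (a j), h.mul_star_eq]
    split_ifs <;> noncomm_ring
  have e2 : star (a k) * a l * (star (a i) * a j) =
      (if i = l then star (a k) * a j else 0) - star (a k) * star (a i) * (a l * a j) := by
    rw [mul_assoc, ← mul_assoc (a l), h.mul_star_eq]
    simp only [eq_comm (a := l)]
    split_ifs <;> noncomm_ring
  rw [Ring.lie_def, e1, e2, h.mul_eq_neg l j, h.star_mul_star_eq_neg k i]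
  noncomm_ring

theorem commute_star_mul_self (h : IsCAR a) {k l : ι} (hkl : k ≠ l) :
    Commute (star (a k) * a k) (a l) := by
  have h1 := h.mul_star_eq l k
  rw [if_neg hkl.symm, zero_sub] at h1
  rw [Commute, SemiconjBy, ← mul_assoc, h1, mul_assoc, h.mul_eq_neg k l]
  noncomm_ring

theorem commute_star_mul_self_star (h : IsCAR a) {k l : ι} (hkl : k ≠ l) :
    Commute (star (a k) * a k) (star (a l)) := by
  simpa using (h.commute_star_mul_self hkl).star_star

end Algebraic

section Algebra

variable {ι A : Type*} [DecidableEq ι] [Ring A] [StarRing A] [Algebra ℂ A] {a : ι → A}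

theorem mul_self (h : IsCAR a) (i : ι) : a i * a i = 0 := by
  have h1 := h.anticomm i i
  rw [← two_smul ℂ] at h1
  exact (smul_eq_zero_iff_right two_ne_zero).1 h1

/-- By bilinearity from `lie_star_mul`: the two contractions assemble into `X * Y` and `Y * X`, with
no central term. -/
theorem lie_secondQuant [Fintype ι] (h : IsCAR a) (X Y : Matrix ι ι ℂ) :
    ⁅secondQuant a X, secondQuant a Y⁆ = secondQuant a ⁅X, Y⁆ := by
  have e : ⁅secondQuant a X, secondQuant a Y⁆ = ∑ i, ∑ j, ∑ k, ∑ l,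
      (X i j * Y k l) • ⁅star (a i) * a j, star (a k) * a l⁆ := by
    have sq (R : Matrix ι ι ℂ) :
        secondQuant a R = ∑ p : ι × ι, R p.1 p.2 • (star (a p.1) * a p.2) := by
      rw [Fintype.sum_prod_type]; rfl
    rw [sq, sq]
    simp only [Ring.lie_def, Finset.sum_mul_sum, smul_mul_smul_comm]
    rw [Finset.sum_comm (f := fun p q : ι × ι =>
      (Y p.1 p.2 * X q.1 q.2) • (star (a p.1) * a p.2 * (star (a q.1) * a q.2)))]
    simp only [← Finset.sum_sub_distrib, mul_comm (Y _ _), ← smul_sub, Fintype.sum_prod_type]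
  have e1 : ∑ i, ∑ j, ∑ k, ∑ l,
      (X i j * Y k l) • (if j = k then star (a i) * a l else 0) = secondQuant a (X * Y) := by
    simp only [secondQuant, smul_ite, smul_zero, Matrix.mul_apply, Finset.sum_smul]
    refine Finset.sum_congr rfl fun i _ => ?_
    rw [Finset.sum_comm (s := Finset.univ (α := ι)) (f := fun l j => (X i j * Y j l) • _)]
    refine Finset.sum_congr rfl fun j _ => ?_
    rw [Finset.sum_comm]
    simp
  have e2 : ∑ i, ∑ j, ∑ k, ∑ l,
      (X i j * Y k l) • (if i = l then star (a k) * a j else 0) = secondQuant a (Y * X) := by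
    simp only [secondQuant, smul_ite, smul_zero, Matrix.mul_apply, Finset.sum_smul,
      Finset.sum_ite_eq, Finset.mem_univ, if_true]
    rw [Finset.sum_comm, Finset.sum_comm (s := Finset.univ (α := ι))
      (f := fun k j => ∑ i, (Y k i * X i j) • (star (a k) * a j))]
    refine Finset.sum_congr rfl fun j _ => ?_
    rw [Finset.sum_comm]
    simp only [mul_comm (X _ _)]
  rw [e]
  simp only [h.lie_star_mul, smul_sub, Finset.sum_sub_distrib]
  rw [e1, e2, Ring.lie_def]
  simp only [secondQuant, Matrix.sub_apply, sub_smul, Finset.sum_sub_distrib]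

theorem star_mul_self_mul_star_mul_self (h : IsCAR a) (i : ι) :
    star (a i) * a i * (star (a i) * a i) = star (a i) * a i := by
  have h1 := h.mul_star_eq i i
  rw [mul_assoc, ← mul_assoc (a i), h1, if_pos rfl, sub_mul, mul_assoc (star (a i)), h.mul_self]
  simp

/-- There is a common eigenvector of the number operators with any prescribed occupation. -/
theorem exists_ne_zero_forall_number_mul [Nontrivial A] (h : IsCAR a) (p : ι → Prop)
    [DecidablePred p] (s : Finset ι) :
    ∃ X : A, X ≠ 0 ∧ ∀ k ∈ s, star (a k) * a k * X = if p k then X else 0 := by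
  induction s using Finset.induction_on with
  | empty => exact ⟨1, one_ne_zero, by simp⟩
  | insert k s hk ih =>
    obtain ⟨X, hX0, hX⟩ := ih
    -- Elements of the algebra under left multiplication play the role of state vectors. A `Z`
    -- commuting with the other number operators keeps the occupations already fixed.
    suffices H : ∃ Z : A, Z * X ≠ 0 ∧ (∀ l ≠ k, Commute (star (a l) * a l) Z) ∧
        star (a k) * a k * (Z * X) = if p k then Z * X else 0 by
      obtain ⟨Z, h0, hc, he⟩ := H
      refine ⟨Z * X, h0, fun l hl => ?_⟩
      rcases eq_or_ne l k with rfl | hlk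
      · exact he
      · rw [← mul_assoc, (hc l hlk).eq, mul_assoc,
          hX l ((Finset.mem_insert.1 hl).resolve_left hlk)]
        split_ifs <;> simp
    have c1 (l : ι) (hl : l ≠ k) := h.commute_star_mul_self hl
    have c2 (l : ι) (hl : l ≠ k) := h.commute_star_mul_self_star hl
    have hid := h.star_mul_self_mul_star_mul_self k
    have hcar := h.mul_star_eq k k
    rw [if_pos rfl] at hcar
    by_cases hp : p k <;> simp only [hp, if_true, if_false]
    -- Either the projection onto the filled mode is nonzero, or the mode is empty and creation
    -- fills it without killing `X`.
    · by_cases hz : star (a k) * a k * X = 0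
      · refine ⟨star (a k), fun h0 => hX0 ?_, c2, ?_⟩
        · have h1 : a k * star (a k) * X = X := by rw [hcar, sub_mul, hz, one_mul, sub_zero]
          rw [← h1, mul_assoc, h0, mul_zero]
        · rw [← mul_assoc, mul_assoc (star (a k)), hcar, mul_sub, mul_one, sub_mul, mul_assoc _ _ X,
            hz, mul_zero, sub_zero]
      · exact ⟨_, hz, fun l hl => (c2 l hl).mul_right (c1 l hl), by rw [← mul_assoc, hid]⟩
    -- The same alternative for an empty mode, with annihilation in place of creation.
    · by_cases hz : (1 - star (a k) * a k) * X = 0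
      · refine ⟨a k, fun h0 => hX0 ?_, c1, ?_⟩
        · rw [sub_mul, one_mul, sub_eq_zero] at hz
          rw [hz, mul_assoc, h0, mul_zero]
        · rw [← mul_assoc, mul_assoc (star (a k)), h.mul_self, mul_zero, zero_mul]
      · exact ⟨_, hz, fun l hl => (Commute.one_right _).sub_right ((c2 l hl).mul_right (c1 l hl)),
          by rw [← mul_assoc, mul_sub, mul_one, hid, sub_self, zero_mul]⟩

end Algebra

section Normed

variable {ι A : Type*} [DecidableEq ι] [NormedRing A] [StarRing A] [CStarRing A]
  [NormedAlgebra ℂ A] [StarModule ℂ A] {a : ι → A}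

/-- The number operator is a projection, so `1 - 2n` is a self-adjoint involution, hence unitary. -/
theorem norm_number_sub_half_le [Nontrivial A] (h : IsCAR a) (i : ι) :
    ‖star (a i) * a i - (1 / 2 : ℂ) • 1‖ ≤ 1 / 2 := by
  have hu : 1 - (2 : ℂ) • (star (a i) * a i) ∈ unitary A := by
    have hs : star (1 - (2 : ℂ) • (star (a i) * a i)) = 1 - (2 : ℂ) • (star (a i) * a i) := by
      simp
    have hm : (1 - (2 : ℂ) • (star (a i) * a i)) * (1 - (2 : ℂ) • (star (a i) * a i)) = 1 := by
      simp only [mul_sub, sub_mul, smul_mul_smul_comm, h.star_mul_self_mul_star_mul_self, one_mul,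
        mul_one]
      module
    rw [Unitary.mem_iff, hs]
    exact ⟨hm, hm⟩
  have e : star (a i) * a i - (1 / 2 : ℂ) • 1 =
      (-(1 / 2) : ℂ) • (1 - (2 : ℂ) • (star (a i) * a i)) := by
    module
  rw [e, norm_smul, CStarRing.norm_of_mem_unitary hu]
  norm_num

/-- The norm of a traceless combination of the number operators. -/
theorem norm_sum_smul_number [Nontrivial A] [Fintype ι] (h : IsCAR a) {μ : ι → ℝ}
    (hμ : ∑ k, μ k = 0) :
    ‖∑ k, (μ k : ℂ) • (star (a k) * a k)‖ = (∑ k, |μ k|) / 2 := by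
  apply le_antisymm
  -- Since the weights sum to zero, shifting every number operator by `1/2` costs nothing and halves
  -- the term-by-term bound.
  · have e : ∑ k, (μ k : ℂ) • (star (a k) * a k) =
        ∑ k, (μ k : ℂ) • (star (a k) * a k - (1 / 2 : ℂ) • 1) := by
      simp only [smul_sub, Finset.sum_sub_distrib]
      rw [← Finset.sum_smul, ← Complex.ofReal_sum, hμ]
      simp
    rw [e, Finset.sum_div]
    refine norm_sum_le_of_le _ fun k _ => ?_
    rw [norm_smul, Complex.norm_real, Real.norm_eq_abs, div_eq_mul_one_div |μ k|]
    exact mul_le_mul_of_nonneg_left (h.norm_number_sub_half_le k) (abs_nonneg _)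
  -- Filling exactly the modes of positive weight gives the eigenvalue `∑ max (μ k) 0`, which is
  -- half of `∑ |μ k|` because the weights sum to zero.
  · obtain ⟨X, hX0, hX⟩ := h.exists_ne_zero_forall_number_mul (fun k => 0 < μ k) Finset.univ
    have e : (∑ k, (μ k : ℂ) • (star (a k) * a k)) * X = (((∑ k, |μ k|) / 2 : ℝ) : ℂ) • X := by
      have h1 (k : ι) : (μ k : ℂ) • (star (a k) * a k) * X = ((max (μ k) 0 : ℝ) : ℂ) • X := by
        rw [smul_mul_assoc, hX k (Finset.mem_univ k)]
        split_ifs with hk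
        · rw [max_eq_left hk.le]
        · rw [max_eq_right (not_lt.1 hk)]; simp
      have h2 : (∑ k, |μ k|) / 2 = ∑ k, max (μ k) 0 := by
        have h3 : ∑ k, max (μ k) 0 = ∑ k, (μ k / 2 + |μ k| / 2) :=
          Finset.sum_congr rfl fun k _ => by
            rcases le_total 0 (μ k) with hk | hk
            · rw [max_eq_left hk, abs_of_nonneg hk]; ring
            · rw [max_eq_right hk, abs_of_nonpos hk]; ring
        rw [h3, Finset.sum_add_distrib, ← Finset.sum_div, ← Finset.sum_div, hμ]
        ring
      rw [Finset.sum_mul, Finset.sum_congr rfl fun k _ => h1 k, ← Finset.sum_smul, h2]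
      simp
    have hn := norm_mul_le (∑ k, (μ k : ℂ) • (star (a k) * a k)) X
    rw [e, norm_smul, Complex.norm_real] at hn
    exact (le_abs_self _).trans (le_of_mul_le_mul_right hn (norm_pos_iff.2 hX0))

end Normed

section Rotation

variable {ι A : Type*} [Fintype ι] [DecidableEq ι] [Ring A] [StarRing A] [Algebra ℂ A]
  [StarModule ℂ A] {a : ι → A}

/-- A unitary change of the one-particle basis preserves the canonical anticommutation
relations. -/
theorem rotate (h : IsCAR a) {U : Matrix ι ι ℂ} (hU : star U * U = 1) :
    IsCAR fun k => ∑ i, star (U i k) • a i where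
  anticomm k l := by
    simp only [Finset.sum_mul_sum, smul_mul_smul_comm]
    rw [Finset.sum_comm (f := fun i j => (star (U i l) * star (U j k)) • (a i * a j)),
      ← Finset.sum_add_distrib]
    refine Finset.sum_eq_zero fun i _ => ?_
    rw [← Finset.sum_add_distrib]
    refine Finset.sum_eq_zero fun j _ => ?_
    rw [mul_comm (star (U j l)), ← smul_add, h.anticomm, smul_zero]
  anticomm_star k l := by
    simp only [star_sum, star_smul, star_star, Finset.sum_mul_sum, smul_mul_smul_comm]
    rw [Finset.sum_comm (f := fun i j => (U i l * star (U j k)) • (star (a i) * a j)),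
      ← Finset.sum_add_distrib]
    have h1 (i j : ι) : (star (U i k) * U j l) • (a i * star (a j)) +
        (U j l * star (U i k)) • (star (a j) * a i) =
          if i = j then (star (U i k) * U i l) • (1 : A) else 0 := by
      rw [mul_comm (U j l), ← smul_add, h.anticomm_star]
      split_ifs with hij
      · rw [hij]
      · rw [smul_zero]
    simp only [← Finset.sum_add_distrib, h1, Finset.sum_ite_eq, Finset.mem_univ, if_true]
    rw [← Finset.sum_smul]
    have h2 := congrFun (congrFun hU k) l
    rw [Matrix.mul_apply] at h2
    simp only [Matrix.star_apply] at h2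
    rw [h2, Matrix.one_apply]
    split_ifs <;> simp

/-- Together with `rotate`, this reduces a diagonalized quadratic Hamiltonian to number operators of
new fermionic modes. -/
theorem secondQuant_conj_diagonal (a : ι → A) (U : Matrix ι ι ℂ) (d : ι → ℂ) :
    secondQuant a (U * Matrix.diagonal d * star U) =
      ∑ k, d k • (star (∑ i, star (U i k) • a i) * ∑ i, star (U i k) • a i) := by
  simp only [secondQuant, star_sum, star_smul, star_star, Finset.sum_mul_sum, smul_mul_smul_comm,
    Finset.smul_sum, smul_smul]
  rw [Finset.sum_comm (γ := ι) (f := fun k i => ∑ j, (d k * (U i k * star (U j k))) • _)]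
  refine Finset.sum_congr rfl fun i _ => ?_
  rw [Finset.sum_comm]
  refine Finset.sum_congr rfl fun j _ => ?_
  rw [Matrix.mul_apply, Finset.sum_smul]
  refine Finset.sum_congr rfl fun k _ => ?_
  rw [Matrix.mul_diagonal, Matrix.star_apply]
  congr 1
  ring

end Rotation

end IsCAR

/-! ### The Jordan-Wigner operators -/

section JordanWigner

variable {M : Type*} [LinearOrder M]

/-- The Jordan-Wigner sign `(-1) ^ #{k ∈ S | k < m}`. -/
def jwSign (m : M) (S : Finset M) : ℂ := (-1) ^ (S.filter fun k => k < m).card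

theorem jwSign_erase_of_lt {m k : M} {S : Finset M} (hk : k ∈ S) (hkm : k < m) :
    jwSign m (S.erase k) = -jwSign m S := by
  have hmem : k ∈ S.filter fun j => j < m := Finset.mem_filter.2 ⟨hk, hkm⟩
  rw [jwSign, jwSign, Finset.filter_erase, ← Finset.card_erase_add_one hmem, pow_succ]
  ring

theorem jwSign_erase_of_le {m k : M} (S : Finset M) (hmk : m ≤ k) :
    jwSign m (S.erase k) = jwSign m S := by
  rw [jwSign, jwSign, Finset.filter_erase, Finset.erase_eq_of_notMem (by simp [hmk])]

theorem jwSign_insert_of_lt {m k : M} {S : Finset M} (hk : k ∉ S) (hkm : k < m) :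
    jwSign m (insert k S) = -jwSign m S := by
  have h := jwSign_erase_of_lt (Finset.mem_insert_self k S) hkm
  rw [Finset.erase_insert hk] at h
  rw [h, neg_neg]

theorem jwSign_insert_of_le {m k : M} (S : Finset M) (hmk : m ≤ k) :
    jwSign m (insert k S) = jwSign m S := by
  rw [← jwSign_erase_of_le (insert k S) hmk, Finset.erase_insert_eq_erase,
    jwSign_erase_of_le S hmk]

theorem jwSign_mul_self (m : M) (S : Finset M) : jwSign m S * jwSign m S = 1 := by
  rw [jwSign, ← mul_pow]; simp

theorem star_jwSign (m : M) (S : Finset M) : star (jwSign m S) = jwSign m S := by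
  simp [jwSign]

theorem annihilation_apply (m : M) (T S : Finset M) :
    annihilation m T S = if m ∈ S ∧ T = S.erase m then jwSign m S else 0 := rfl

theorem creation_apply (m : M) (T S : Finset M) :
    creation m T S = if m ∉ S ∧ T = insert m S then jwSign m S else 0 := by
  rw [creation, Matrix.conjTranspose_apply, annihilation_apply]
  have h1 : (m ∈ T ∧ S = T.erase m) ↔ (m ∉ S ∧ T = insert m S) := by
    constructor
    · rintro ⟨h, rfl⟩
      exact ⟨Finset.notMem_erase _ _, (Finset.insert_erase h).symm⟩
    · rintro ⟨h, rfl⟩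
      exact ⟨Finset.mem_insert_self _ _, (Finset.erase_insert h).symm⟩
  simp only [h1]
  split_ifs with h
  · rw [star_jwSign, h.2, jwSign_insert_of_le S le_rfl]
  · exact star_zero _

variable [Fintype M]

theorem mul_annihilation_apply (X : FockOp M) (m : M) (T S : Finset M) :
    (X * annihilation m) T S = if m ∈ S then jwSign m S * X T (S.erase m) else 0 := by
  rw [Matrix.mul_apply, Finset.sum_eq_single (S.erase m)]
  · rw [annihilation_apply]
    by_cases h : m ∈ S <;> simp [h, mul_comm]
  · intro U _ hU
    rw [annihilation_apply, if_neg (fun h => hU h.2), mul_zero]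
  · simp

theorem mul_creation_apply (X : FockOp M) (m : M) (T S : Finset M) :
    (X * creation m) T S = if m ∉ S then jwSign m S * X T (insert m S) else 0 := by
  rw [Matrix.mul_apply, Finset.sum_eq_single (insert m S)]
  · rw [creation_apply]
    by_cases h : m ∈ S <;> simp [h, mul_comm]
  · intro U _ hU
    rw [creation_apply, if_neg (fun h => hU h.2), mul_zero]
  · simp

theorem annihilation_anticomm_of_lt {i j : M} (hij : i < j) :
    annihilation i * annihilation j + annihilation j * annihilation i = (0 : FockOp M) := by
  ext T S
  rw [Matrix.add_apply, mul_annihilation_apply, mul_annihilation_apply, annihilation_apply,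
    annihilation_apply, Finset.erase_right_comm (a := j), jwSign_erase_of_le S hij.le]
  by_cases hi : i ∈ S
  · by_cases hj : j ∈ S
    · rw [jwSign_erase_of_lt hi hij]
      simp only [Finset.mem_erase, hi, hj, hij.ne, hij.ne', ne_eq, not_false_eq_true, true_and,
        if_true, Matrix.zero_apply]
      split_ifs <;> ring
    · simp [hj, hi]
  · simp [hi]

theorem annihilation_creation_anticomm_of_ne {i j : M} (hij : i ≠ j) :
    annihilation i * creation j + creation j * annihilation i = (0 : FockOp M) := by
  ext T S
  rw [Matrix.add_apply, mul_annihilation_apply, mul_creation_apply, annihilation_apply,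
    creation_apply, Finset.erase_insert_of_ne hij.symm]
  by_cases hi : i ∈ S
  · by_cases hj : j ∈ S
    · simp [hj, hi, hij.symm]
    -- Only the operator of the larger mode sees the other mode in its sign string, so exactly one
    -- of the four signs flips.
    · have hs : jwSign j S * jwSign i (insert j S) + jwSign i S * jwSign j (S.erase i) = 0 := by
        rcases lt_or_gt_of_ne hij with h | h
        · rw [jwSign_insert_of_le S h.le, jwSign_erase_of_lt hi h]; ring
        · rw [jwSign_insert_of_lt hj h, jwSign_erase_of_le S h.le]; ring
      simp only [Finset.mem_erase, Finset.mem_insert, hi, hj, or_true, and_false,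
        not_false_eq_true, true_and, if_true, Matrix.zero_apply]
      split_ifs
      · exact hs
      · simp
  · simp [hi, hij]

theorem annihilation_creation_anticomm_self (i : M) :
    annihilation i * creation i + creation i * annihilation i = (1 : FockOp M) := by
  ext T S
  rw [Matrix.add_apply, mul_annihilation_apply, mul_creation_apply, annihilation_apply,
    creation_apply]
  by_cases hi : i ∈ S
  · simp only [hi, not_true_eq_false, if_false, zero_add, if_true, Finset.notMem_erase,
      not_false_eq_true, true_and, Finset.insert_erase, jwSign_erase_of_le S le_rfl, mul_ite,
      jwSign_mul_self, mul_zero, Matrix.one_apply]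
  · simp only [hi, not_false_eq_true, if_true, if_false, add_zero, Finset.mem_insert_self, true_and,
      Finset.erase_insert, jwSign_insert_of_le S le_rfl, mul_ite, jwSign_mul_self, mul_zero,
      Matrix.one_apply]

/-- The Jordan-Wigner annihilation operators satisfy the canonical anticommutation relations. -/
theorem isCAR_annihilation : IsCAR (annihilation : M → FockOp M) where
  anticomm i j := by
    rcases lt_trichotomy i j with h | rfl | h
    · exact annihilation_anticomm_of_lt h
    · ext T S
      simp [mul_annihilation_apply, annihilation_apply]
    · rw [add_comm]; exact annihilation_anticomm_of_lt h
  anticomm_star i j := by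
    split_ifs with h
    · subst h; exact annihilation_creation_anticomm_self i
    · exact annihilation_creation_anticomm_of_ne h

end JordanWigner

/-! ### The trace norm -/

section TraceNorm

variable {n : Type*} [Fintype n] [DecidableEq n]

/-- Dependence on the characteristic polynomial alone makes invariance under reindexing and
similarity immediate. -/
theorem traceNorm_eq_sum_roots (A : Matrix n n ℂ) :
    traceNorm A = ((A.conjTranspose * A).charpoly.roots.map fun z => Real.sqrt z.re).sum := by
  rw [(Matrix.isHermitian_conjTranspose_mul_self A).roots_charpoly_eq_eigenvalues,
    Multiset.map_map]
  simp [traceNorm]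

theorem traceNorm_neg (A : Matrix n n ℂ) : traceNorm (-A) = traceNorm A := by
  simp [traceNorm_eq_sum_roots]

theorem traceNorm_submatrix {m : Type*} [Fintype m] [DecidableEq m] (A : Matrix n n ℂ)
    (e : m ≃ n) : traceNorm (A.submatrix e e) = traceNorm A := by
  rw [traceNorm_eq_sum_roots, traceNorm_eq_sum_roots, Matrix.conjTranspose_submatrix,
    Matrix.submatrix_mul_equiv, ← Matrix.charpoly_reindex e.symm (A.conjTranspose * A)]
  rfl

theorem eq_eigenvectorUnitary_mul_diagonal {K : Matrix n n ℂ} (hK : K.IsHermitian) :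
    K = (hK.eigenvectorUnitary : Matrix n n ℂ) *
      Matrix.diagonal (fun k => (hK.eigenvalues k : ℂ)) *
        star (hK.eigenvectorUnitary : Matrix n n ℂ) := by
  conv_lhs => rw [hK.spectral_theorem, Unitary.conjStarAlgAut_apply]
  rfl

theorem traceNorm_of_isHermitian {K : Matrix n n ℂ} (hK : K.IsHermitian) :
    traceNorm K = ∑ k, |hK.eigenvalues k| := by
  have h := eq_eigenvectorUnitary_mul_diagonal hK
  set U := hK.eigenvectorUnitary
  set D := Matrix.diagonal (fun k => (hK.eigenvalues k : ℂ)) with hD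
  have h2 : K.conjTranspose * K = (U : Matrix n n ℂ) * (D * D * star (U : Matrix n n ℂ)) := by
    have hU : star (U : Matrix n n ℂ) * U = 1 := Unitary.coe_star_mul_self U
    rw [hK.eq]
    calc K * K = (U : Matrix n n ℂ) * D * (star (U : Matrix n n ℂ) * U) * D *
          star (U : Matrix n n ℂ) := by
            conv_lhs => rw [h]
            simp only [mul_assoc]
      _ = _ := by
            rw [hU]
            simp only [mul_assoc, one_mul]
  rw [traceNorm_eq_sum_roots, h2, Matrix.charpoly_mul_comm, mul_assoc, Unitary.coe_star_mul_self,
    mul_one, hD, Matrix.diagonal_mul_diagonal, Matrix.charpoly_diagonal, Polynomial.roots_prod]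
  · simp only [Polynomial.roots_X_sub_C, Multiset.bind_singleton, Multiset.map_map]
    simp [Real.sqrt_mul_self_eq_abs]
  · exact Finset.prod_ne_zero_iff.2 fun k _ => Polynomial.X_sub_C_ne_zero _

end TraceNorm

/-! ### Hopping Hamiltonians -/

section Hopping

open scoped Kronecker

/-- The annihilation operators, indexed by pairs of a site and a spin direction. -/
def siteSpinAnnihilation (L : ℕ) (p : Site L × Spin) : FockOp (Mode L) :=
  annihilation (mode p.1 p.2)

theorem isCAR_siteSpinAnnihilation (L : ℕ) : IsCAR (siteSpinAnnihilation L) := by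
  refine isCAR_annihilation.comp (f := fun p : Site L × Spin => mode p.1 p.2) ?_
  rintro ⟨⟨x, y⟩, σ⟩ ⟨⟨x', y'⟩, σ'⟩ h
  simpa [mode, and_assoc] using h

/-- Spin is a spectator: equal hopping in both sectors is the one-particle matrix tensored with the
identity. -/
theorem hopping_eq_secondQuant {L : ℕ} (R : Matrix (Site L) (Site L) ℂ) :
    hopping R = secondQuant (siteSpinAnnihilation L) (R ⊗ₖ (1 : Matrix Spin Spin ℂ)) := by
  symm
  refine (Fintype.sum_prod_type_right _).trans ?_
  refine Finset.sum_congr rfl fun σ _ => Finset.sum_congr rfl fun i _ => ?_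
  refine (Fintype.sum_prod_type_right _).trans ?_
  rw [Finset.sum_eq_single σ]
  · refine Finset.sum_congr rfl fun j _ => ?_
    simp only [Matrix.kroneckerMap_apply, Matrix.one_apply_eq, mul_one]
    rfl
  · intro σ' _ h
    refine Finset.sum_eq_zero fun j _ => ?_
    simp [Matrix.one_apply_ne h.symm]
  · simp

theorem hopping_add {L : ℕ} (R R' : Matrix (Site L) (Site L) ℂ) :
    hopping (R + R') = hopping R + hopping R' := by
  simp only [hopping, Matrix.add_apply, add_smul, Finset.sum_add_distrib]

theorem lie_hopping {L : ℕ} (R R' : Matrix (Site L) (Site L) ℂ) :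
    ⁅hopping R, hopping R'⁆ = hopping ⁅R, R'⁆ := by
  simp only [hopping_eq_secondQuant]
  rw [(isCAR_siteSpinAnnihilation L).lie_secondQuant]
  congr 1
  simp only [Ring.lie_def, ← Matrix.mul_kronecker_mul, one_mul]
  ext p q
  simp [sub_mul]

theorem isHermitian_hopping {L : ℕ} {R : Matrix (Site L) (Site L) ℂ} (hR : R.IsHermitian) :
    (hopping R).IsHermitian := by
  rw [Matrix.IsHermitian]
  simp only [hopping, Matrix.conjTranspose_sum, Matrix.conjTranspose_smul,
    Matrix.conjTranspose_mul, creation, Matrix.conjTranspose_conjTranspose, hR.apply]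
  refine Finset.sum_congr rfl fun σ _ => ?_
  rw [Finset.sum_comm]

/-- The operator norm of the free-fermionic Hamiltonian of a traceless Hermitian matrix, with two
spin directions, is the trace norm of the matrix. -/
theorem norm_hopping {L : ℕ} {K : Matrix (Site L) (Site L) ℂ} (hK : K.IsHermitian)
    (ht : K.trace = 0) : ‖hopping K‖ = traceNorm K := by
  have hU : (hK.eigenvectorUnitary : Matrix (Site L) (Site L) ℂ) ⊗ₖ (1 : Matrix Spin Spin ℂ) ∈
      unitary (Matrix (Site L × Spin) (Site L × Spin) ℂ) :=
    Matrix.kronecker_mem_unitary hK.eigenvectorUnitary.2 (one_mem _)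
  set U := (hK.eigenvectorUnitary : Matrix (Site L) (Site L) ℂ) ⊗ₖ (1 : Matrix Spin Spin ℂ)
    with hUdef
  have hd : K ⊗ₖ (1 : Matrix Spin Spin ℂ) =
      U * Matrix.diagonal (fun p => ((hK.eigenvalues p.1 : ℝ) : ℂ)) * star U := by
    have h1 : Matrix.diagonal (fun p : Site L × Spin => ((hK.eigenvalues p.1 : ℝ) : ℂ)) =
        Matrix.diagonal (fun k => ((hK.eigenvalues k : ℝ) : ℂ)) ⊗ₖ (1 : Matrix Spin Spin ℂ) := by
      rw [← Matrix.diagonal_one, Matrix.diagonal_kronecker_diagonal]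
      simp
    rw [h1, hUdef, Matrix.star_eq_conjTranspose, Matrix.conjTranspose_kronecker,
      ← Matrix.mul_kronecker_mul, ← Matrix.mul_kronecker_mul, Matrix.conjTranspose_one, one_mul,
      one_mul, ← Matrix.star_eq_conjTranspose, ← eq_eigenvectorUnitary_mul_diagonal hK]
  have hcar := (isCAR_siteSpinAnnihilation L).rotate (Unitary.mem_iff.1 hU).1
  have h0 : ∑ k, hK.eigenvalues k = 0 := by
    have h := hK.trace_eq_sum_eigenvalues
    rw [ht] at h
    rw [← Complex.ofReal_eq_zero, Complex.ofReal_sum]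
    exact h.symm
  rw [hopping_eq_secondQuant, hd, IsCAR.secondQuant_conj_diagonal,
    hcar.norm_sum_smul_number (μ := fun p => hK.eigenvalues p.1), traceNorm_of_isHermitian hK]
  -- Each eigenvalue occurs once per spin, and this factor two cancels the one half.
  · simp [Fintype.sum_prod_type, ← Finset.mul_sum]
  · simp [Fintype.sum_prod_type, ← Finset.mul_sum, h0]

theorem isHermitian_interactionH (L : ℕ) (u : ℝ) : (interactionH L u).IsHermitian := by
  have hn (m : Mode L) : (number m).conjTranspose = number m := by
    simp [number, creation, Matrix.conjTranspose_mul]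
  have hc {m m' : Mode L} (h : m ≠ m') : Commute (number m) (number m') :=
    ((isCAR_annihilation (M := Mode L)).commute_star_mul_self_star h).mul_right
      (isCAR_annihilation.commute_star_mul_self h)
  rw [Matrix.IsHermitian, interactionH, Matrix.conjTranspose_smul, Matrix.conjTranspose_sum]
  congr 1
  · simp
  refine Finset.sum_congr rfl fun i _ => ?_
  have hne : mode i 1 ≠ mode i 0 := by simp [mode]
  -- A product of Hermitian factors is Hermitian once they commute, as number operators of distinct
  -- modes do.
  have h := ((hc hne).sub_left (Commute.smul_left (Commute.one_left _) (1 / 2 : ℂ))).sub_right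
    (Commute.smul_right (Commute.one_right _) (1 / 2 : ℂ))
  rw [Matrix.conjTranspose_mul]
  simpa [hn] using h.eq

end Hopping

/-! ### Nested commutators of Hermitian matrices -/

theorem isHermitian_lie_lie {n : Type*} [Fintype n] {P G X : Matrix n n ℂ} (hP : P.IsHermitian) (hG : G.IsHermitian)
    (hX : X.IsHermitian) : (⁅⁅P, G⁆, X⁆ : Matrix n n ℂ).IsHermitian := by
  rw [Matrix.IsHermitian]
  simp only [Ring.lie_def, Matrix.conjTranspose_sub, Matrix.conjTranspose_mul, hP.eq, hG.eq, hX.eq]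
  noncomm_ring

theorem trace_lie {n : Type*} [Fintype n] (A B : Matrix n n ℂ) : (⁅A, B⁆ : Matrix n n ℂ).trace = 0 := by
  rw [Ring.lie_def, Matrix.trace_sub, Matrix.trace_mul_comm, sub_self]

/-! ### Pink and gold edges -/

section Edges

variable {L : ℕ}

/-- Removes reduction modulo the variable `L`, leaving case splits that `omega` can handle. -/
theorem succ_mod_eq (x : Fin L) : (x.val + 1) % L = if x.val + 1 = L then 0 else x.val + 1 := by
  split_ifs with h
  · rw [h, Nat.mod_self]
  · exact Nat.mod_eq_of_lt (by omega)

theorem pinkEdge_iff (hL : Even L) (i j : Site L) : PinkEdge i j ↔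
    LatticeAdj i j ∧ i.1.val / 2 = j.1.val / 2 ∧ i.2.val / 2 = j.2.val / 2 := by
  obtain ⟨m, hm⟩ := hL
  refine and_congr_right fun _ => ⟨?_, ?_⟩
  · rintro ⟨c, ⟨p, hp⟩, ⟨q, hq⟩, hi, hj⟩
    simp only [InPlaquette, succ_mod_eq, Fin.ext_iff] at hi hj
    constructor <;> split_ifs at * <;> omega
  · rintro ⟨h1, h2⟩
    refine ⟨(⟨2 * (i.1.val / 2), by omega⟩, ⟨2 * (i.2.val / 2), by omega⟩), by simp, by simp, ?_, ?_⟩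
    all_goals
      simp only [InPlaquette, Fin.ext_iff]
      -- Pink plaquettes never wrap around: `L` is even, so an even coordinate below `L` has its
      -- successor below `L`.
      constructor <;> rw [Nat.mod_eq_of_lt (by omega)] <;> omega

theorem exists_odd_corner (hL : Even L) {x y : Fin L}
    (h : (x.val + 1) % L / 2 = (y.val + 1) % L / 2) :
    ∃ c : Fin L, Odd c.val ∧ (x = c ∨ x.val = (c.val + 1) % L) ∧
      (y = c ∨ y.val = (c.val + 1) % L) := by
  obtain ⟨m, hm⟩ := hL
  have hc : ∃ c : ℕ, c < L ∧ c % 2 = 1 ∧ (c = x.val ∨ (c + 1) % L = x.val) := by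
    rcases Nat.even_or_odd' x.val with ⟨k, hk | hk⟩
    · rcases Nat.eq_zero_or_pos k with h0 | h0
      -- Coordinate `0` belongs to the wrapped pair `{L - 1, 0}`, whose lower corner is odd because
      -- `L` is even.
      · refine ⟨L - 1, by omega, by omega, Or.inr ?_⟩
        rw [show L - 1 + 1 = L by omega, Nat.mod_self]; omega
      · refine ⟨2 * k - 1, by omega, by omega, Or.inr ?_⟩
        rw [Nat.mod_eq_of_lt (by omega)]; omega
    · exact ⟨x.val, x.2, by omega, Or.inl rfl⟩
  obtain ⟨c, hcL, hc2, hcx⟩ := hc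
  refine ⟨⟨c, hcL⟩, Nat.odd_iff.2 hc2, ?_⟩
  have h1 := succ_mod_eq (⟨c, hcL⟩ : Fin L)
  simp only [succ_mod_eq, Fin.ext_iff] at h h1 ⊢
  rw [h1] at hcx
  split_ifs at * <;> omega

theorem goldEdge_iff (hL : Even L) (i j : Site L) : GoldEdge i j ↔
    LatticeAdj i j ∧ (i.1.val + 1) % L / 2 = (j.1.val + 1) % L / 2 ∧
      (i.2.val + 1) % L / 2 = (j.2.val + 1) % L / 2 := by
  refine and_congr_right fun _ => ⟨?_, ?_⟩
  · obtain ⟨m, hm⟩ := hL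
    rintro ⟨c, ⟨p, hp⟩, ⟨q, hq⟩, hi, hj⟩
    simp only [InPlaquette, succ_mod_eq, Fin.ext_iff] at hi hj ⊢
    constructor <;> split_ifs at * <;> omega
  · rintro ⟨h1, h2⟩
    obtain ⟨c, hc, hci, hcj⟩ := exists_odd_corner hL h1
    obtain ⟨d, hd, hdi, hdj⟩ := exists_odd_corner hL h2
    exact ⟨(c, d), hc, hd, ⟨hci, hdi⟩, ⟨hcj, hdj⟩⟩

/-- Going round the cycle, edges alternate between the two pairings. For `L = 2` the single pair
`{0, 1}` would belong to both, hence `4 ≤ L`. -/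
theorem cycleAdj_half_eq (hL : Even L) (hL4 : 4 ≤ L) {x y : Fin L} (h : CycleAdj x y) :
    (x.val / 2 = y.val / 2 ↔ ¬(x.val + 1) % L / 2 = (y.val + 1) % L / 2) := by
  obtain ⟨m, hm⟩ := hL
  simp only [CycleAdj, succ_mod_eq] at h ⊢
  split_ifs at * <;> omega

theorem hopR_eq_add (hL : Even L) (hL4 : 4 ≤ L) (τ : ℝ) : hopR L τ = pinkR L τ + goldR L τ := by
  ext i j
  simp only [hopR, pinkR, goldR, Matrix.of_apply, Matrix.add_apply]
  by_cases h : LatticeAdj i j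
  · have h1 : PinkEdge i j ↔ ¬GoldEdge i j := by
      rw [pinkEdge_iff hL, goldEdge_iff hL]
      simp only [h, true_and]
      -- A lattice edge keeps one coordinate fixed, so only the moving one decides the colour.
      rcases h with ⟨h1, h2⟩ | ⟨h1, h2⟩
      · simpa only [h1, true_and] using cycleAdj_half_eq hL hL4 h2
      · simpa only [h1, and_true] using cycleAdj_half_eq hL hL4 h2
    by_cases h2 : GoldEdge i j
    · rw [if_pos h, if_neg (mt h1.1 (not_not.2 h2)), if_pos h2, zero_add]
    · rw [if_pos h, if_pos (h1.2 h2), if_neg h2, add_zero]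
  · have h1 : ¬PinkEdge i j := fun h' => h h'.1
    have h2 : ¬GoldEdge i j := fun h' => h h'.1
    rw [if_neg h, if_neg h1, if_neg h2, add_zero]

theorem latticeAdj_symm {i j : Site L} (h : LatticeAdj i j) : LatticeAdj j i := by
  rcases h with ⟨h1, h2⟩ | ⟨h1, h2⟩
  exacts [Or.inl ⟨h1.symm, h2.symm⟩, Or.inr ⟨h1.symm, h2.symm⟩]

theorem pinkEdge_comm (i j : Site L) : PinkEdge i j ↔ PinkEdge j i :=
  ⟨fun ⟨h, c, h1, h2, h3, h4⟩ => ⟨latticeAdj_symm h, c, h1, h2, h4, h3⟩,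
    fun ⟨h, c, h1, h2, h3, h4⟩ => ⟨latticeAdj_symm h, c, h1, h2, h4, h3⟩⟩

theorem goldEdge_comm (i j : Site L) : GoldEdge i j ↔ GoldEdge j i :=
  ⟨fun ⟨h, c, h1, h2, h3, h4⟩ => ⟨latticeAdj_symm h, c, h1, h2, h4, h3⟩,
    fun ⟨h, c, h1, h2, h3, h4⟩ => ⟨latticeAdj_symm h, c, h1, h2, h4, h3⟩⟩

theorem isHermitian_pinkR (τ : ℝ) : (pinkR L τ).IsHermitian := by
  ext i j
  simp only [pinkR, Matrix.conjTranspose_apply, Matrix.of_apply, pinkEdge_comm j i]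
  split_ifs <;> simp

theorem isHermitian_goldR (τ : ℝ) : (goldR L τ).IsHermitian := by
  ext i j
  simp only [goldR, Matrix.conjTranspose_apply, Matrix.of_apply, goldEdge_comm j i]
  split_ifs <;> simp

/-! ### Translation symmetry between pink and gold -/

/-- The translation by one step along the cycle of length `L`. -/
def cycleShift (L : ℕ) : Fin L ≃ Fin L := finRotate L

theorem cycleShift_val (x : Fin L) : (cycleShift L x).val = (x.val + 1) % L := by
  rcases L with _ | n
  · exact x.elim0
  · rw [cycleShift, finRotate_apply, Fin.val_add_one, succ_mod_eq]
    simp [Fin.ext_iff]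

theorem cycleAdj_cycleShift (x y : Fin L) :
    CycleAdj (cycleShift L x) (cycleShift L y) ↔ CycleAdj x y := by
  have h (x y : Fin L) : (x.val + 1) % L = y.val ↔ cycleShift L x = y := by
    rw [Fin.ext_iff, cycleShift_val]
  simp only [CycleAdj, h, EmbeddingLike.apply_eq_iff_eq]

/-- The translation of the lattice by one step in both directions. -/
def diagonalShift (L : ℕ) : Site L ≃ Site L := (cycleShift L).prodCongr (cycleShift L)

theorem latticeAdj_diagonalShift (i j : Site L) :
    LatticeAdj (diagonalShift L i) (diagonalShift L j) ↔ LatticeAdj i j := by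
  simp only [LatticeAdj, diagonalShift, Equiv.prodCongr_apply, Prod.map_fst, Prod.map_snd,
    cycleAdj_cycleShift, EmbeddingLike.apply_eq_iff_eq]

/-- Two steps carry the even-odd pairs to even-odd pairs, also across the seam since `L` is even. -/
theorem cycleShift_cycleShift_half (hL : Even L) (x y : Fin L) :
    ((cycleShift L x).val + 1) % L / 2 = ((cycleShift L y).val + 1) % L / 2 ↔
      x.val / 2 = y.val / 2 := by
  obtain ⟨m, hm⟩ := hL
  have hx := x.2
  have hy := y.2
  rw [succ_mod_eq (cycleShift L x), succ_mod_eq (cycleShift L y)]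
  simp only [cycleShift_val, succ_mod_eq]
  split_ifs <;> omega

theorem pinkR_submatrix (hL : Even L) (τ : ℝ) :
    (pinkR L τ).submatrix (diagonalShift L) (diagonalShift L) = goldR L τ := by
  ext i j
  simp only [pinkR, goldR, Matrix.submatrix_apply, Matrix.of_apply, pinkEdge_iff hL,
    goldEdge_iff hL, latticeAdj_diagonalShift]
  simp only [diagonalShift, Equiv.prodCongr_apply, Prod.map_fst, Prod.map_snd, cycleShift_val]

theorem goldR_submatrix (hL : Even L) (τ : ℝ) :
    (goldR L τ).submatrix (diagonalShift L) (diagonalShift L) = pinkR L τ := by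
  ext i j
  simp only [pinkR, goldR, Matrix.submatrix_apply, Matrix.of_apply, pinkEdge_iff hL,
    goldEdge_iff hL, latticeAdj_diagonalShift]
  simp only [diagonalShift, Equiv.prodCongr_apply, Prod.map_fst, Prod.map_snd,
    cycleShift_cycleShift_half hL]

theorem submatrix_lie {n : Type*} [Fintype n] [DecidableEq n] (A B : Matrix n n ℂ) (e : n ≃ n) :
    (⁅A, B⁆ : Matrix n n ℂ).submatrix e e = ⁅A.submatrix e e, B.submatrix e e⁆ := by
  simp only [Ring.lie_def, Matrix.submatrix_mul_equiv, Matrix.submatrix_sub]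
  rfl

/-- The diagonal translation swaps the colours, and antisymmetry of the inner commutator restores
their order up to a sign. -/
theorem traceNorm_lie_lie_pinkR (hL : Even L) (τ : ℝ) :
    traceNorm ⁅⁅pinkR L τ, goldR L τ⁆, pinkR L τ⁆ =
      traceNorm ⁅⁅pinkR L τ, goldR L τ⁆, goldR L τ⁆ := by
  have h : ⁅⁅goldR L τ, pinkR L τ⁆, goldR L τ⁆ = -⁅⁅pinkR L τ, goldR L τ⁆, goldR L τ⁆ := by
    simp only [Ring.lie_def]; noncomm_ring
  rw [← traceNorm_submatrix _ (diagonalShift L), submatrix_lie, submatrix_lie, pinkR_submatrix hL,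
    goldR_submatrix hL, h, traceNorm_neg]

end Edges

end PlaquetteTrotter

/-! ### Assembly of the claims -/

open PlaquetteTrotter in
theorem mainTheorem5 (L : ℕ) (hL : Even L) (hL4 : 4 ≤ L) (u τ : ℝ) :
    -- the plaquette decomposition of the Hamiltonian
    hopH L τ = pinkH L τ + goldH L τ ∧
    hubbardH L u τ = interactionH L u + pinkH L τ + goldH L τ ∧
    -- the error of a plaquette Trotter step
    (∀ t : ℝ,
      ‖evolution (hubbardH L u τ) t - plaquetteStep L u τ t‖ ≤ wPLAQ L u τ * |t| ^ 3) ∧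
    -- the error constants in terms of nested commutators
    wSO2 L u τ =
      (1 / 12) * ‖⁅⁅interactionH L u, hopH L τ⁆, hopH L τ⁆‖ +
        (1 / 24) * ‖⁅⁅interactionH L u, hopH L τ⁆, interactionH L u⁆‖ ∧
    wPLAQ L u τ = wSO2 L u τ +
      (1 / 12) * ‖⁅⁅pinkH L τ, goldH L τ⁆, goldH L τ⁆‖ +
        (1 / 24) * ‖⁅⁅pinkH L τ, goldH L τ⁆, pinkH L τ⁆‖ ∧
    -- the symmetry between pink and gold
    ‖⁅⁅pinkH L τ, goldH L τ⁆, goldH L τ⁆‖ = ‖⁅⁅pinkH L τ, goldH L τ⁆, pinkH L τ⁆‖ ∧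
    wPLAQ L u τ = wSO2 L u τ + (3 / 24) * ‖⁅⁅pinkH L τ, goldH L τ⁆, goldH L τ⁆‖ ∧
    -- the free-fermionic evaluation
    ‖⁅⁅pinkH L τ, goldH L τ⁆, goldH L τ⁆‖ =
      traceNorm ⁅⁅pinkR L τ, goldR L τ⁆, goldR L τ⁆ ∧
    wPLAQ L u τ = wSO2 L u τ + (3 / 24) * traceNorm ⁅⁅pinkR L τ, goldR L τ⁆, goldR L τ⁆ := by
  have hp := isHermitian_pinkR (L := L) τ
  have hg := isHermitian_goldR (L := L) τ
  have hdec : hopH L τ = pinkH L τ + goldH L τ := by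
    rw [hopH, hopR_eq_add hL hL4, hopping_add, pinkH, goldH]
  have hdec' : hubbardH L u τ = interactionH L u + pinkH L τ + goldH L τ := by
    rw [hubbardH, hdec, add_assoc]
  have hso2 : wSO2 L u τ =
      (1 / 12) * ‖⁅⁅interactionH L u, hopH L τ⁆, hopH L τ⁆‖ +
        (1 / 24) * ‖⁅⁅interactionH L u, hopH L τ⁆, interactionH L u⁆‖ := by
    have h0 : Finset.Ioi (0 : Fin 2) = {1} := rfl
    have h1 : Finset.Ioi (1 : Fin 2) = ∅ := rfl
    simp [wSO2, trotterW, Fin.sum_univ_two, h0, h1]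
  have hplaq : wPLAQ L u τ = wSO2 L u τ +
      (1 / 12) * ‖⁅⁅pinkH L τ, goldH L τ⁆, goldH L τ⁆‖ +
        (1 / 24) * ‖⁅⁅pinkH L τ, goldH L τ⁆, pinkH L τ⁆‖ := by
    have h0 : Finset.Ioi (0 : Fin 3) = {1, 2} := rfl
    have h1 : Finset.Ioi (1 : Fin 3) = {2} := rfl
    have h2 : Finset.Ioi (2 : Fin 3) = ∅ := rfl
    -- By bilinearity the `b = 0` terms of `W_PLAQ` reassemble into `W_SO2`; `b = 1` gives the two
    -- extra terms and `b = 2` nothing.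
    have e1 (X P G : FockOp (Mode L)) : ⁅⁅X, P + G⁆, P + G⁆ =
        ⁅⁅X, P⁆, P⁆ + ⁅⁅X, P⁆, G⁆ + (⁅⁅X, G⁆, P⁆ + ⁅⁅X, G⁆, G⁆) := by
      simp only [Ring.lie_def]; noncomm_ring
    have e2 (X P G : FockOp (Mode L)) : ⁅⁅X, P + G⁆, X⁆ = ⁅⁅X, P⁆, X⁆ + ⁅⁅X, G⁆, X⁆ := by
      simp only [Ring.lie_def]; noncomm_ring
    rw [hso2, hdec, e1, e2]
    simp [wPLAQ, trotterW, Fin.sum_univ_three, h0, h1, h2]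
    ring
  have hgold : ‖⁅⁅pinkH L τ, goldH L τ⁆, goldH L τ⁆‖ =
      traceNorm ⁅⁅pinkR L τ, goldR L τ⁆, goldR L τ⁆ := by
    rw [pinkH, goldH, lie_hopping, lie_hopping, norm_hopping (isHermitian_lie_lie hp hg hg)
      (trace_lie _ _)]
  have hpink : ‖⁅⁅pinkH L τ, goldH L τ⁆, pinkH L τ⁆‖ =
      traceNorm ⁅⁅pinkR L τ, goldR L τ⁆, goldR L τ⁆ := by
    rw [pinkH, goldH, lie_hopping, lie_hopping, norm_hopping (isHermitian_lie_lie hp hg hp)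
      (trace_lie _ _), traceNorm_lie_lie_pinkR hL]
  have hsym := hgold.trans hpink.symm
  have h3 : wPLAQ L u τ = wSO2 L u τ + (3 / 24) * ‖⁅⁅pinkH L τ, goldH L τ⁆, goldH L τ⁆‖ := by
    rw [hplaq, ← hsym]; ring
  refine ⟨hdec, hdec', fun t => ?_, hso2, hplaq, hsym, h3, hgold, hgold ▸ h3⟩
  rw [hdec', hplaq, hso2, hdec, plaquetteStep]
  refine (norm_evolution_sub_three_term_step_le (isHermitian_interactionH L u)
    (isHermitian_hopping hp) (isHermitian_hopping hg) t).trans_eq ?_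
  rw [← pinkH, ← goldH]
  ring
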